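/- All logarithms are to base $2$. A conditional sampling oracle for a distribution $\mu$ over $[n]=\{1,\ldots,n\}$, called with a non-empty set $A\subseteq[n]$, returns an element of $A$ drawn according to $\mu$ conditioned on $A$, independently of everything else (and a uniformly drawn element of $A$ if $\mu(A)=0$). An adaptive algorithm taking $t$ conditional samples calls the oracle successively with sets $A_1,\ldots,A_t$, where $A_i$ may depend on the previous answers $j_1,\ldots,j_{i-1}$ and on the algorithm's internal coin tosses, and then accepts or rejects based on $j_1,\ldots,j_t$ and its coin tosses. It is an adaptive tester for a property $\mathcal P$ of distributions over $[n]$, with distance parameter $\epsilon$ and error probability $\delta$, if it accepts every $\mu\in\mathcal P$ with probability at least $1-\delta$, and rejects with probability at least $1-\delta$ every $\mu$ such that $\frac12\sum_i|\mu(i)-\mu'(i)|\ge\epsilon$ for all $\mu'\in\mathcal P$. Let $\mathcal P$ be the property of being the uniform distribution over some set $U\subseteq[n]$ of size exactly $2^{2k}$ for some integer $k$ with $\frac18\log n\le k\le\frac38\log n$. The even (respectively odd) uniblock distribution over distributions picks such an integer $k$ uniformly, then picks uniformly a set $U\subseteq[n]$ of size $2^{2k}$ (respectively $2^{2k+1}$),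 and outputs the uniform distribution over $U$. Theorem. (1) $\mathcal P$ is label-invariant, i.e. invariant under permutations of $[n]$. (2) Testing $\mathcal P$ requires $\Omega(\sqrt{\log\log n})$ conditional samples, even adaptively: for every fixed $0<\delta<\frac12$ there is $N$ such that for all $n\ge N$ and all $0<\epsilon\le\frac12$, every adaptive tester for $\mathcal P$ over $[n]$ with distance parameter $\epsilon$ and error probability $\delta$ takes $t>\sqrt{\frac1{32}\log\log n}$ conditional samples. (3) Every possible outcome of the odd uniblock distribution has variation distance at least $\frac12$ from every member of $\mathcal P$, that is, from every possible outcome of the even one. Moreover, no adaptive algorithm taking $t\le\sqrt{\frac1{32}\log\log n}$ conditional samples distinguishes the two: for every $\eta>0$ there is $N$ such that for all $n\ge N$, all such $t$ and all such algorithms, the acceptance probabilities under an input drawn from the even and from the odd uniblock distribution differ by at most $\eta$. -/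

import Mathlib

open MeasureTheory

noncomputable section

namespace CondTest

/-- Probability distributions over a domain of `n` elements. -/
abbrev Dist (n : ℕ) : Type := stdSimplex ℝ (Fin n)

/-- A property of distributions: for every domain size `n`, a set of distributions over `Fin n`. -/
abbrev DistProperty : Type := (n : ℕ) → Set (Dist n)

/-- The property does not change when the elements of the domain are permuted. -/
def LabelInvariant (P : DistProperty) : Prop :=
  ∀ (n : ℕ) (σ : Equiv.Perm (Fin n)) (μ ν : Dist n),
    (∀ i, ν.1 i = μ.1 (σ i)) → μ ∈ P n → ν ∈ P n

/-- Variation distance `d(p, q) = ½ ∑ |p i - q i|`. -/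
def variationDist {n : ℕ} (p q : Fin n → ℝ) : ℝ := (1 / 2) * ∑ i, |p i - q i|

/-- `μ` is `ε`-far from the set `S` of distributions. -/
def IsFar {n : ℕ} (ε : ℝ) (μ : Dist n) (S : Set (Dist n)) : Prop :=
  ∀ ν ∈ S, ε ≤ variationDist μ.1 ν.1

/-- The probability that the conditional sampling oracle for `p`, called with the set `A`,
answers `j`. A set of probability zero is answered by a uniformly drawn member of it. -/
def condProb {n : ℕ} (p : Fin n → ℝ) (A : Finset (Fin n)) (j : Fin n) : ℝ :=
  if j ∈ A then
    if ∑ i ∈ A, p i = 0 then 1 / (A.card : ℝ) else p j / ∑ i ∈ A, p i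
  else 0

/-- The sets that an algorithm may submit to the conditional sampling oracle. -/
abbrev QuerySet (n : ℕ) : Type := {A : Finset (Fin n) // A.Nonempty}

/-- An adaptive (randomized) algorithm with a conditional sampling oracle for a distribution over
`Fin n`. The internal coin tosses are an element of an arbitrary probability space. Based on these
and on the list `[j₁, …, jᵢ]` of all answers received so far, it generates the next set to condition
upon (`query`), and at the end to accept (`true`) or to reject (`false`; `decision`). -/
structure AdaptiveAlgorithm (n : ℕ) where
  Coins : Type
  [coinSpace : MeasurableSpace Coins]
  coinLaw : Measure Coins
  [isProbability : IsProbabilityMeasure coinLaw]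
  query : Coins → List (Fin n) → QuerySet n
  decision : Coins → List (Fin n) → Bool
  measurable_query : ∀ h A, MeasurableSet {c | query c h = A}
  measurable_decision : ∀ h b, MeasurableSet {c | decision c h = b}

attribute [instance] AdaptiveAlgorithm.coinSpace AdaptiveAlgorithm.isProbability

/-- For fixed outcomes `c` of the coin tosses and an input distribution `p`: the probability that
the algorithm, having received the answers `h` and having `r` more samples to take, ends up with the
decision `b`. -/
def AdaptiveAlgorithm.outputProbFrom {n : ℕ} (T : AdaptiveAlgorithm n) (c : T.Coins)
    (p : Fin n → ℝ) (b : Bool) : ℕ → List (Fin n) → ℝ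
  | 0, h => if T.decision c h = b then 1 else 0
  | r + 1, h => ∑ j, condProb p (T.query c h).1 j * T.outputProbFrom c p b r (h ++ [j])

/-- The probability, over the internal coin tosses and the answers of the oracle, that the
algorithm gives the output `b` after taking `t` conditional samples from `p`. -/
def AdaptiveAlgorithm.outputProb {n : ℕ} (T : AdaptiveAlgorithm n) (t : ℕ) (p : Fin n → ℝ)
    (b : Bool) : ℝ :=
  ∫ c, T.outputProbFrom c p b t [] ∂T.coinLaw

/-- `T`, taking `t` conditional samples, is a correct adaptive tester for the property `P` on the
domain of size `n` with distance parameter `ε` and error probability `δ`. -/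
def IsAdaptiveTester (P : DistProperty) (ε δ : ℝ) (n t : ℕ) (T : AdaptiveAlgorithm n) : Prop :=
  (∀ μ ∈ P n, 1 - δ ≤ T.outputProb t μ.1 true) ∧
  (∀ μ : Dist n, IsFar ε μ (P n) → 1 - δ ≤ T.outputProb t μ.1 false)

/-- The `U`-distribution: the uniform distribution over `U`. -/
def uDist {n : ℕ} (U : Finset (Fin n)) : Fin n → ℝ :=
  fun i => if i ∈ U then 1 / (U.card : ℝ) else 0

/-- The integers `k` with `(log n) / 8 ≤ k ≤ 3 (log n) / 8`, logarithm to base 2. -/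
def blockExponents (n : ℕ) : Finset ℕ :=
  Finset.Icc ⌈Real.logb 2 n / 8⌉₊ ⌊3 * Real.logb 2 n / 8⌋₊

/-- The possible outcomes of the even (`s = 0`) and of the odd (`s = 1`) uniblock distribution over
distributions: the `U`-distributions with `|U| = 2 ^ (2 * k + s)` for some `k` as above. -/
def uniblock (s : ℕ) : DistProperty := fun n =>
  {μ | ∃ k ∈ blockExponents n, ∃ U : Finset (Fin n), U.card = 2 ^ (2 * k + s) ∧ μ.1 = uDist U}

/-- Expectation of `f μ`, where `μ` is drawn according to the even (`s = 0`) or odd (`s = 1`)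
uniblock distribution over distributions: `k` is uniform in `blockExponents n`, then `U` is uniform
among the subsets of size `2 ^ (2 * k + s)`, and `μ` is the `U`-distribution. -/
def uniblockExpect (s n : ℕ) (f : (Fin n → ℝ) → ℝ) : ℝ :=
  (∑ k ∈ blockExponents n,
    (∑ U ∈ Finset.powersetCard (2 ^ (2 * k + s)) (Finset.univ : Finset (Fin n)), f (uDist U)) /
      ((Finset.powersetCard (2 ^ (2 * k + s)) (Finset.univ : Finset (Fin n))).card : ℝ)) /
    ((blockExponents n).card : ℝ)

end CondTest

end

/-! Fix the coins, so the algorithm is deterministic. Reveal the random support lazily: `S` is the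
part already seen, `V` the region about which nothing is known, and the support of size `m` is `S ∪
W` with `W` a uniform subset of `V` of size `m - |S|`. Let a query `A` meet `V` in `a` elements, and
let `q` be a precision parameter. If `a * m ≤ n / 4 ^ q`, then `W` most likely misses `A`, so the
answer is governed by `S` alone and `A` may be deleted from `V` (`abs_step_sub_of_small`). If `a * m
≥ 4 ^ q * n`, then `|A ∩ W|` is large and concentrated, so the answer is nearly a uniform element of
`A ∩ V`, which moves from `V` to `S` (`abs_step_sub_of_large`). In both cases the law of the answer
does not involve `m`, so neighbouring sizes `2 ^ (2k)` and `2 ^ (2k+1)` look alike up to `O(2 ^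
(-q))`.

For a given `a`, only `2q + 1` exponents `k` fall between the two regimes
(`card_filter_intermediate_le`); for these the trivial bound 1 is used. The remaining exponents
split into a "small" and a "large" class, treated recursively. Answers are averaged over rather than
branched on, so the recursion is a binary tree, and after `t` queries at most `(2 ^ t - 1) * (2q +
1)` exponents are lost (`sum_abs_supportAvg_sub_le`). With `4 ^ q` about `log n` there are at least
`4 ^ q / 8` exponents, so the lost fraction tends to 0 whenever `t ≤ q`; the square root in the
theorem is not needed for this.

Odd outcomes are far from the property because an even and an odd size differ by a factor of at
least 2. A tester would therefore distinguish the two distributions, which gives the lower bound. -/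

noncomputable section

namespace CondTest

/-! ### Averages over subsets of fixed size; hypergeometric moments -/

section SubsetAverage

/-- The average of `g W` over the subsets `W` of `V` of size `w`. -/
def subsetAvg {α : Type*} (w : ℕ) (V : Finset α) (g : Finset α → ℝ) : ℝ :=
  (∑ W ∈ Finset.powersetCard w V, g W) / (V.card.choose w : ℝ)

lemma subsetAvg_const {α : Type*} {w : ℕ} {V : Finset α} (h : w ≤ V.card) (a : ℝ) :
    subsetAvg w V (fun _ => a) = a := by
  have : (V.card.choose w : ℝ) ≠ 0 := by
    exact_mod_cast (Nat.choose_pos h).ne'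
  simp [subsetAvg, Finset.card_powersetCard]
  field_simp

lemma subsetAvg_congr {α : Type*} {w : ℕ} {V : Finset α} {g g' : Finset α → ℝ}
    (h : ∀ W ⊆ V, W.card = w → g W = g' W) : subsetAvg w V g = subsetAvg w V g' := by
  unfold subsetAvg
  congr 1
  refine Finset.sum_congr rfl fun W hW => ?_
  rw [Finset.mem_powersetCard] at hW
  exact h W hW.1 hW.2

lemma subsetAvg_mono {α : Type*} {w : ℕ} {V : Finset α} {g g' : Finset α → ℝ}
    (h : ∀ W ⊆ V, W.card = w → g W ≤ g' W) : subsetAvg w V g ≤ subsetAvg w V g' := by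
  unfold subsetAvg
  gcongr with W hW
  rw [Finset.mem_powersetCard] at hW
  exact h W hW.1 hW.2

lemma subsetAvg_add {α : Type*} (w : ℕ) (V : Finset α) (g g' : Finset α → ℝ) :
    subsetAvg w V (fun W => g W + g' W) = subsetAvg w V g + subsetAvg w V g' := by
  simp [subsetAvg, Finset.sum_add_distrib, add_div]

lemma subsetAvg_sub {α : Type*} (w : ℕ) (V : Finset α) (g g' : Finset α → ℝ) :
    subsetAvg w V (fun W => g W - g' W) = subsetAvg w V g - subsetAvg w V g' := by
  simp [subsetAvg, Finset.sum_sub_distrib, sub_div]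

lemma subsetAvg_const_mul {α : Type*} (w : ℕ) (V : Finset α) (a : ℝ) (g : Finset α → ℝ) :
    subsetAvg w V (fun W => a * g W) = a * subsetAvg w V g := by
  simp [subsetAvg, ← Finset.mul_sum, mul_div_assoc]

lemma subsetAvg_sum {α ι : Type*} (w : ℕ) (V : Finset α) (s : Finset ι)
    (g : ι → Finset α → ℝ) :
    subsetAvg w V (fun W => ∑ j ∈ s, g j W) = ∑ j ∈ s, subsetAvg w V (g j) := by
  simp only [subsetAvg, ← Finset.sum_div]
  rw [Finset.sum_comm]

lemma subsetAvg_nonneg {α : Type*} {w : ℕ} {V : Finset α} {g : Finset α → ℝ}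
    (h : ∀ W ⊆ V, W.card = w → 0 ≤ g W) : 0 ≤ subsetAvg w V g := by
  refine div_nonneg (Finset.sum_nonneg fun W hW => ?_) (Nat.cast_nonneg _)
  rw [Finset.mem_powersetCard] at hW
  exact h W hW.1 hW.2

lemma subsetAvg_le_one {α : Type*} {w : ℕ} {V : Finset α} {g : Finset α → ℝ}
    (hw : w ≤ V.card) (h : ∀ W ⊆ V, W.card = w → g W ≤ 1) : subsetAvg w V g ≤ 1 :=
  (subsetAvg_mono h).trans_eq (subsetAvg_const hw 1)

variable {α : Type*} [DecidableEq α]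

/-- Double counting: a pair `(W, j)` with `j ∈ A ∩ W` corresponds to `(j, W.erase j)`. This single
exchange yields the hypergeometric mean and second moment, and the analysis of large queries. -/
lemma sum_powersetCard_succ_inter (V A : Finset α) (w : ℕ) (G : α → Finset α → ℝ) :
    ∑ W ∈ Finset.powersetCard (w + 1) V, ∑ j ∈ A ∩ W, G j W =
      ∑ j ∈ A ∩ V, ∑ W ∈ Finset.powersetCard w (V.erase j), G j (insert j W) := by
  rw [Finset.sum_sigma', Finset.sum_sigma']
  refine Finset.sum_bij' (fun x _ => ⟨x.2, x.1.erase x.2⟩) (fun y _ => ⟨insert y.1 y.2, y.1⟩)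
    ?_ ?_ ?_ ?_ ?_
  · rintro ⟨W, j⟩ h
    simp only [Finset.mem_sigma, Finset.mem_powersetCard, Finset.mem_inter] at h ⊢
    obtain ⟨⟨hWV, hc⟩, hjA, hjW⟩ := h
    refine ⟨⟨hjA, hWV hjW⟩, Finset.erase_subset_erase _ hWV, ?_⟩
    rw [Finset.card_erase_of_mem hjW, hc]; rfl
  · rintro ⟨j, W⟩ h
    simp only [Finset.mem_sigma, Finset.mem_powersetCard, Finset.mem_inter] at h ⊢
    obtain ⟨⟨hjA, hjV⟩, hWV, hc⟩ := h
    have hj : j ∉ W := fun h => by simpa using hWV h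
    refine ⟨⟨?_, ?_⟩, hjA, Finset.mem_insert_self _ _⟩
    · exact Finset.insert_subset hjV (hWV.trans (Finset.erase_subset _ _))
    · rw [Finset.card_insert_of_notMem hj, hc]
  · rintro ⟨W, j⟩ h
    simp only [Finset.mem_sigma, Finset.mem_powersetCard, Finset.mem_inter] at h
    simp [Finset.insert_erase h.2.2]
  · rintro ⟨j, W⟩ h
    simp only [Finset.mem_sigma, Finset.mem_powersetCard, Finset.mem_inter] at h
    have hj : j ∉ W := fun h' => by simpa using h.2.1 h'
    simp [Finset.erase_insert hj]
  · rintro ⟨W, j⟩ h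
    simp only [Finset.mem_sigma, Finset.mem_powersetCard, Finset.mem_inter] at h
    simp [Finset.insert_erase h.2.2]

/-- Drawing a set and then going through its elements in `A` amounts to choosing an element of `A`
first and completing it to a set. -/
lemma subsetAvg_succ_sum_inter (V A : Finset α) (w : ℕ) (G : α → Finset α → ℝ) :
    subsetAvg (w + 1) V (fun W => ∑ j ∈ A ∩ W, G j W) =
      ((w + 1 : ℕ) : ℝ) / V.card *
        ∑ j ∈ A ∩ V, subsetAvg w (V.erase j) (fun W => G j (insert j W)) := by
  unfold subsetAvg
  rw [sum_powersetCard_succ_inter, Finset.sum_div, Finset.mul_sum]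
  refine Finset.sum_congr rfl fun j hj => ?_
  have hjV := (Finset.mem_inter.1 hj).2
  rw [Finset.card_erase_of_mem hjV]
  obtain ⟨v, hv⟩ : ∃ v, V.card = v + 1 :=
    ⟨V.card - 1, by have := Finset.card_pos.2 ⟨j, hjV⟩; omega⟩
  rw [hv, Nat.add_sub_cancel]
  have h := Nat.add_one_mul_choose_eq v w
  have h' : ((v : ℝ) + 1) * v.choose w = (v + 1).choose (w + 1) * ((w : ℝ) + 1) := by
    exact_mod_cast h
  rcases Nat.eq_zero_or_pos (v.choose w) with h0 | h0
  · have : (v + 1).choose (w + 1) = 0 := by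
      rw [h0] at h; simpa using h
    simp [h0, this]
  · have h1 : (v.choose w : ℝ) ≠ 0 := by exact_mod_cast h0.ne'
    have h2 : ((v + 1).choose (w + 1) : ℝ) ≠ 0 := by
      intro h3; rw [h3] at h'
      have : ((v : ℝ) + 1) * v.choose w ≠ 0 := by positivity
      exact this (by linarith)
    push_cast
    field_simp
    linear_combination (∑ W ∈ Finset.powersetCard w (V.erase j), G j (insert j W)) * h'

/-- The mean of the hypergeometric distribution. -/
lemma subsetAvg_card_inter {V : Finset α} {w : ℕ} (hw : w ≤ V.card) (A : Finset α) :
    subsetAvg w V (fun W => ((A ∩ W).card : ℝ)) = w * (A ∩ V).card / V.card := by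
  cases w with
  | zero => simp [subsetAvg]
  | succ w =>
    have := subsetAvg_succ_sum_inter V A w (fun _ _ => 1)
    simp only [Finset.sum_const, nsmul_eq_mul, mul_one] at this
    rw [this, Finset.sum_congr rfl (g := fun _ => (1 : ℝ))]
    · simp; ring
    · intro j hj
      refine subsetAvg_const ?_ 1
      rw [Finset.card_erase_of_mem (Finset.mem_inter.1 hj).2]; omega

/-- The variance of the hypergeometric distribution is at most its mean. -/
lemma subsetAvg_card_inter_sub_sq_le {V : Finset α} {w : ℕ} (hw : w ≤ V.card) (A : Finset α) :
    subsetAvg w V (fun W => (((A ∩ W).card : ℝ) - w * (A ∩ V).card / V.card) ^ 2) ≤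
      w * (A ∩ V).card / V.card := by
  set lam : ℝ := w * (A ∩ V).card / V.card with hlam
  have hlam0 : 0 ≤ lam := by positivity
  have hsq : subsetAvg w V (fun W => ((A ∩ W).card : ℝ) ^ 2) ≤ lam * (1 + lam) := by
    cases w with
    | zero => simp [subsetAvg, hlam]
    | succ w =>
      have key := subsetAvg_succ_sum_inter V A w (fun _ W => ((A ∩ W).card : ℝ))
      simp only [Finset.sum_const, nsmul_eq_mul, ← sq] at key
      rw [key]
      -- Once `j` is known to be drawn, the other elements form a uniform subset of `V.erase j`,
      -- whose expected intersection with `A` is at most `lam`.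
      have : ∀ j ∈ A ∩ V, subsetAvg w (V.erase j) (fun W => ((A ∩ insert j W).card : ℝ)) ≤
          1 + lam := by
        intro j hj
        obtain ⟨hjA, hjV⟩ := Finset.mem_inter.1 hj
        have hc : (V.erase j).card = V.card - 1 := Finset.card_erase_of_mem hjV
        have hwV : w ≤ (V.erase j).card := by omega
        rw [subsetAvg_congr (g' := fun W => 1 + ((A ∩ W).card : ℝ)), subsetAvg_add,
          subsetAvg_const hwV, subsetAvg_card_inter hwV]
        · have hA : A ∩ V.erase j = (A ∩ V).erase j := by
            ext x; simp only [Finset.mem_inter, Finset.mem_erase]; tauto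
          rw [hA, Finset.card_erase_of_mem hj, hc]
          obtain ⟨v, hv⟩ : ∃ v, V.card = v + 1 :=
            ⟨V.card - 1, by have := Finset.card_pos.2 ⟨j, hjV⟩; omega⟩
          have hwv : (w : ℝ) ≤ v := by exact_mod_cast (by omega : w ≤ v)
          have ha : (((A ∩ V).card - 1 : ℕ) : ℝ) ≤ (A ∩ V).card := by
            exact_mod_cast Nat.sub_le _ _
          have h1 : (w : ℝ) / v ≤ (w + 1) / (v + 1) := by
            rcases Nat.eq_zero_or_pos v with h0 | h0
            · subst h0; simp; positivity
            · have : (0 : ℝ) < v := by exact_mod_cast h0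
              rw [div_le_div_iff₀ this (by positivity)]
              nlinarith
          rw [hlam, hv, Nat.add_sub_cancel]
          push_cast
          rw [mul_div_right_comm, mul_div_right_comm]
          gcongr
        · intro W hW _
          have hj' : j ∉ A ∩ W := fun h => by simpa using hW (Finset.mem_inter.1 h).2
          rw [Finset.inter_insert_of_mem hjA, Finset.card_insert_of_notMem hj']
          push_cast; ring
      calc _ ≤ ((w + 1 : ℕ) : ℝ) / V.card * ∑ j ∈ A ∩ V, (1 + lam) := by
            gcongr with j hj; exact this j hj
        _ = lam * (1 + lam) := by
            rw [Finset.sum_const, nsmul_eq_mul]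
            conv_rhs => rw [hlam]
            ring
  have hE := subsetAvg_card_inter hw A
  rw [← hlam] at hE
  have : subsetAvg w V (fun W => (((A ∩ W).card : ℝ) - lam) ^ 2) =
      subsetAvg w V (fun W => ((A ∩ W).card : ℝ) ^ 2) - 2 * lam * lam + lam ^ 2 := by
    have h2 : 2 * lam * lam = subsetAvg w V (fun W => 2 * lam * ((A ∩ W).card : ℝ)) := by
      rw [subsetAvg_const_mul, hE]
    rw [h2, ← subsetAvg_sub, ← subsetAvg_const hw (lam ^ 2), ← subsetAvg_add]
    congr 1; ext W; ring
  rw [this]; nlinarith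

/-- Conditioning on missing `A` changes averages by at most the probability of meeting `A`. -/
lemma abs_subsetAvg_sub_sdiff_le {V : Finset α} {w : ℕ} (A : Finset α)
    (hw : w ≤ (V \ A).card) {g : Finset α → ℝ} (h0 : ∀ W ⊆ V, W.card = w → 0 ≤ g W)
    (h1 : ∀ W ⊆ V, W.card = w → g W ≤ 1) :
    |subsetAvg w V g - subsetAvg w (V \ A) g| ≤ w * (A ∩ V).card / V.card := by
  have hwV : w ≤ V.card := hw.trans (Finset.card_le_card Finset.sdiff_subset)
  set x := subsetAvg w (V \ A) g with hx
  have hx0 : 0 ≤ x := subsetAvg_nonneg fun W hW => h0 W (hW.trans Finset.sdiff_subset)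
  have hx1 : x ≤ 1 := subsetAvg_le_one hw fun W hW => h1 W (hW.trans Finset.sdiff_subset)
  have hdiff : subsetAvg w V g - x = subsetAvg w V (fun W => g W - x) := by
    rw [subsetAvg_sub, subsetAvg_const hwV]
  -- Since `x` is the mean over the sets missing `A`, those sets contribute nothing to the average
  -- of `g - x`; each other set contributes at most `1 ≤ |A ∩ W|`.
  have hzero : ∑ W ∈ Finset.powersetCard w (V \ A), (g W - x) = 0 := by
    have hpos : ((V \ A).card.choose w : ℝ) ≠ 0 := by exact_mod_cast (Nat.choose_pos hw).ne'
    rw [Finset.sum_sub_distrib, Finset.sum_const, Finset.card_powersetCard, nsmul_eq_mul, hx,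
      subsetAvg]
    field_simp; ring
  have hsub : Finset.powersetCard w (V \ A) ⊆ Finset.powersetCard w V :=
    Finset.powersetCard_mono Finset.sdiff_subset
  have hind : subsetAvg w V (fun W => g W - x) =
      subsetAvg w V (fun W => if W ∈ Finset.powersetCard w (V \ A) then 0 else g W - x) := by
    unfold subsetAvg
    congr 1
    rw [← Finset.sum_sdiff hsub, hzero, add_zero, ← Finset.sum_sdiff hsub (f := fun W => ite _ _ _),
      Finset.sum_congr rfl (g := fun _ => (0 : ℝ)) (s₁ := Finset.powersetCard w (V \ A)),
      Finset.sum_const_zero, add_zero]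
    · refine Finset.sum_congr rfl fun W hW => ?_
      rw [if_neg (Finset.mem_sdiff.1 hW).2]
    · intro W hW; rw [if_pos hW]
  have hbound : ∀ W ⊆ V, W.card = w →
      |if W ∈ Finset.powersetCard w (V \ A) then 0 else g W - x| ≤ ((A ∩ W).card : ℝ) := by
    intro W hW hc
    split_ifs with hm
    · simp
    · have hne : (A ∩ W).Nonempty := by
        by_contra hne
        rw [Finset.not_nonempty_iff_eq_empty, ← Finset.disjoint_iff_inter_eq_empty] at hne
        exact hm (Finset.mem_powersetCard.2 ⟨Finset.subset_sdiff.2 ⟨hW, hne.symm⟩, hc⟩)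
      have : (1 : ℝ) ≤ (A ∩ W).card := by exact_mod_cast Finset.card_pos.2 hne
      have := h0 W hW hc
      have := h1 W hW hc
      rw [abs_le]; constructor <;> linarith
  rw [hdiff, hind, ← subsetAvg_card_inter hwV A, abs_le]
  constructor
  · rw [← neg_one_mul, ← subsetAvg_const_mul]
    refine subsetAvg_mono fun W hW hc => ?_
    have := (abs_le.1 (hbound W hW hc)).1
    linarith
  · exact subsetAvg_mono fun W hW hc => (abs_le.1 (hbound W hW hc)).2

end SubsetAverage

/-! ### A single query against a partly revealed support -/

section OneStep

variable {n : ℕ}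

lemma sum_uDist_eq_card_inter (U A : Finset (Fin n)) :
    ∑ i ∈ A, uDist U i = (A ∩ U).card / U.card := by
  simp only [uDist, Finset.sum_ite_mem, Finset.sum_const, nsmul_eq_mul]
  ring

lemma condProb_uDist (U A : Finset (Fin n)) (j : Fin n) :
    condProb (uDist U) A j =
      if j ∈ A then
        if A ∩ U = ∅ then 1 / (A.card : ℝ) else if j ∈ U then 1 / ((A ∩ U).card : ℝ) else 0
      else 0 := by
  unfold condProb
  rw [sum_uDist_eq_card_inter]
  by_cases hj : j ∈ A
  · simp only [hj, if_true]
    by_cases h : A ∩ U = ∅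
    · simp [h]
    · have h1 : ((A ∩ U).card : ℝ) ≠ 0 := by
        simpa using h
      have h2 : (U.card : ℝ) ≠ 0 := by
        intro h2
        have : U = ∅ := by simpa using h2
        simp [this] at h
      rw [if_neg (div_ne_zero h1 h2), if_neg h]
      unfold uDist
      split_ifs
      · field_simp
      · simp
  · simp [hj]

lemma condProb_nonneg {p : Fin n → ℝ} (hp : ∀ i, 0 ≤ p i) (A : Finset (Fin n)) (j : Fin n) :
    0 ≤ condProb p A j := by
  unfold condProb
  split_ifs
  · positivity
  · exact div_nonneg (hp j) (Finset.sum_nonneg fun i _ => hp i)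
  · exact le_rfl

lemma sum_condProb (p : Fin n → ℝ) {A : Finset (Fin n)} (hA : A.Nonempty) :
    ∑ j, condProb p A j = 1 := by
  unfold condProb
  rw [Finset.sum_ite_mem, Finset.univ_inter]
  split_ifs with h
  · have : (A.card : ℝ) ≠ 0 := by exact_mod_cast hA.card_pos.ne'
    simp [this]
  · rw [← Finset.sum_div, div_self h]

lemma uDist_nonneg (U : Finset (Fin n)) (i : Fin n) : 0 ≤ uDist U i := by
  unfold uDist; split_ifs <;> positivity

lemma sum_condProb_mul_nonneg {p : Fin n → ℝ} (hp : ∀ i, 0 ≤ p i) (A : Finset (Fin n))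
    {F : Fin n → ℝ} (hF : ∀ j, 0 ≤ F j) : 0 ≤ ∑ j, condProb p A j * F j :=
  Finset.sum_nonneg fun j _ => mul_nonneg (condProb_nonneg hp A j) (hF j)

lemma sum_condProb_mul_le_one {p : Fin n → ℝ} (hp : ∀ i, 0 ≤ p i) {A : Finset (Fin n)}
    (hA : A.Nonempty) {F : Fin n → ℝ} (hF : ∀ j, F j ≤ 1) : ∑ j, condProb p A j * F j ≤ 1 := by
  rw [← sum_condProb p hA]
  exact Finset.sum_le_sum fun j _ => mul_le_of_le_one_right (condProb_nonneg hp A j) (hF j)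

/-- If the unknown part of a query set is small, then the answer is most likely determined by the
elements already known to be in the support. -/
lemma abs_step_sub_of_small {S V A : Finset (Fin n)} {w : ℕ} (hA : A.Nonempty)
    (hw : w ≤ (V \ A).card) {F : Fin n → Finset (Fin n) → ℝ}
    (h0 : ∀ j U, 0 ≤ F j U) (h1 : ∀ j U, F j U ≤ 1) :
    |subsetAvg w V (fun W => ∑ j, condProb (uDist (S ∪ W)) A j * F j (S ∪ W)) -
      ∑ j, condProb (uDist S) A j * subsetAvg w (V \ A) (fun W => F j (S ∪ W))| ≤
      w * (A ∩ V).card / V.card := by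
  have : ∑ j, condProb (uDist S) A j * subsetAvg w (V \ A) (fun W => F j (S ∪ W)) =
      subsetAvg w (V \ A) (fun W => ∑ j, condProb (uDist (S ∪ W)) A j * F j (S ∪ W)) := by
    -- If `W` misses `A`, then `S ∪ W` and `S` have the same trace on `A`, hence the same answer
    -- law, including the uniform fallback when `A` misses `S`.
    simp_rw [← subsetAvg_const_mul]
    rw [← subsetAvg_sum]
    refine subsetAvg_congr fun W hW _ => Finset.sum_congr rfl fun j _ => ?_
    have hWA : ∀ x ∈ A, x ∉ W := fun x hx hxW => (Finset.mem_sdiff.1 (hW hxW)).2 hx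
    have hAS : A ∩ (S ∪ W) = A ∩ S := by
      ext x; simp only [Finset.mem_inter, Finset.mem_union]; have := hWA x; tauto
    congr 1
    rw [condProb_uDist, condProb_uDist, hAS]
    by_cases hj : j ∈ A
    · have := hWA j hj
      simp [hj, this]
    · simp [hj]
  rw [this]
  exact abs_subsetAvg_sub_sdiff_le A hw
    (fun W _ _ => sum_condProb_mul_nonneg (uDist_nonneg _) A fun j => h0 j _)
    (fun W _ _ => sum_condProb_mul_le_one (uDist_nonneg _) hA fun j => h1 j _)

/-- Replaces the random normalisation `r + N` by its approximate value `lam`. The relative deviation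
`(N - lam) / lam` is turned into a quadratic by AM-GM with weight `θ`, so that the variance bound
applies after averaging. -/
lemma inverse_weight_le {X N r R lam θ Y : ℝ} (hl : 0 < lam) (hθ : 0 < θ) (hr : 0 ≤ r)
    (hrR : r ≤ R) (hN : 0 ≤ N) (hX0 : 0 ≤ X) (hXN : X ≤ N) (hY : X / (r + N) ≤ Y) :
    1 / lam * X ≤ Y + (R / lam + (1 / (2 * lam ^ 2 * θ) * (N - lam) ^ 2 + θ / 2)) := by
  have hy : (N - lam) / lam ≤ 1 / (2 * lam ^ 2 * θ) * (N - lam) ^ 2 + θ / 2 := by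
    have h : 1 / (2 * lam ^ 2 * θ) * (N - lam) ^ 2 + θ / 2 - (N - lam) / lam =
        ((N - lam) / lam - θ) ^ 2 / (2 * θ) := by field_simp; ring
    have : 0 ≤ ((N - lam) / lam - θ) ^ 2 / (2 * θ) := by positivity
    linarith
  have hy0 : 0 ≤ 1 / (2 * lam ^ 2 * θ) * (N - lam) ^ 2 + θ / 2 := by positivity
  have hRl : r / lam ≤ R / lam := by gcongr
  have hr0 : 0 ≤ r / lam := by positivity
  rcases (add_nonneg hr hN).eq_or_lt with h | h
  · have : X = 0 := by linarith
    subst this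
    have : 0 ≤ Y := by simpa using hY
    linarith
  · have hX1 : X / (r + N) ≤ 1 := (div_le_one h).2 (by linarith)
    have hX2 : 0 ≤ X / (r + N) := by positivity
    -- Here `(r + N) / lam = 1 + r / lam + (N - lam) / lam`, and its factor `X / (r + N)` lies in
    -- `[0, 1]`, so the correction is at most its positive part.
    have e : 1 / lam * X = X / (r + N) + X / (r + N) * (r / lam + (N - lam) / lam) := by
      field_simp; ring
    rcases le_total 0 (r / lam + (N - lam) / lam) with h' | h'
    · have := mul_le_mul_of_nonneg_right hX1 h'
      linarith
    · have := mul_nonpos_of_nonneg_of_nonpos hX2 h'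
      linarith

/-- Only one direction is needed: answers in `S` can be dropped since `F` is nonnegative, and
applying the bound to `1 - F` supplies the other direction. The choice of `θ` is left open to
balance the variance term. -/
lemma step_of_large_le {S V A : Finset (Fin n)} {w : ℕ} (hSV : Disjoint S V)
    (hw : w + 1 ≤ V.card) (hAV : (A ∩ V).Nonempty) {θ lam : ℝ} (hθ : 0 < θ)
    (hlam : lam = ((w + 1 : ℕ) : ℝ) * (A ∩ V).card / V.card) {F : Fin n → Finset (Fin n) → ℝ}
    (h0 : ∀ j U, 0 ≤ F j U) (h1 : ∀ j U, F j U ≤ 1) :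
    (∑ j ∈ A ∩ V, subsetAvg w (V.erase j) (fun W => F j (insert j S ∪ W))) / (A ∩ V).card ≤
      subsetAvg (w + 1) V (fun W => ∑ j, condProb (uDist (S ∪ W)) A j * F j (S ∪ W)) +
      (S.card / lam + (1 / (lam * θ) + θ) / 2) := by
  have ha : (0 : ℝ) < (A ∩ V).card := by exact_mod_cast hAV.card_pos
  have hv : (0 : ℝ) < V.card := by exact_mod_cast (by omega : 0 < V.card)
  have hl0 : 0 < lam := by rw [hlam]; positivity
  have key := subsetAvg_succ_sum_inter V A w (fun j W => F j (S ∪ W))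
  have e1 : (∑ j ∈ A ∩ V, subsetAvg w (V.erase j) (fun W => F j (insert j S ∪ W))) /
      (A ∩ V).card = subsetAvg (w + 1) V (fun W => 1 / lam * ∑ j ∈ A ∩ W, F j (S ∪ W)) := by
    rw [subsetAvg_const_mul, key, hlam]
    simp only [Finset.union_insert, Finset.insert_union]
    push_cast
    field_simp
  have hvar := subsetAvg_card_inter_sub_sq_le hw A
  rw [← hlam] at hvar
  have e2 : subsetAvg (w + 1) V (fun W => S.card / lam + (1 / (2 * lam ^ 2 * θ) *
      (((A ∩ W).card : ℝ) - lam) ^ 2 + θ / 2)) ≤ S.card / lam + (1 / (lam * θ) + θ) / 2 := by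
    rw [subsetAvg_add, subsetAvg_add, subsetAvg_const hw, subsetAvg_const hw, subsetAvg_const_mul]
    have : 1 / (2 * lam ^ 2 * θ) * lam = 1 / (lam * θ) / 2 := by field_simp
    have h2 := mul_le_mul_of_nonneg_left hvar (by positivity : 0 ≤ 1 / (2 * lam ^ 2 * θ))
    rw [this] at h2
    linarith
  rw [e1]
  refine le_trans ?_ (add_le_add_right e2 _)
  rw [← subsetAvg_add]
  refine subsetAvg_mono fun W hW hc => ?_
  have hdis : Disjoint (A ∩ S) (A ∩ W) :=
    (hSV.mono_right hW).mono Finset.inter_subset_right Finset.inter_subset_right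
  have hcard : (A ∩ (S ∪ W)).card = (A ∩ S).card + (A ∩ W).card := by
    rw [Finset.inter_union_distrib_left, Finset.card_union_of_disjoint hdis]
  have hS : ((A ∩ S).card : ℝ) ≤ S.card := by
    exact_mod_cast Finset.card_le_card Finset.inter_subset_right
  have hge : (∑ j ∈ A ∩ W, F j (S ∪ W)) / ((A ∩ S).card + (A ∩ W).card : ℝ) ≤
      ∑ j, condProb (uDist (S ∪ W)) A j * F j (S ∪ W) := by
    rw [Finset.sum_div]
    refine (Finset.sum_le_sum fun j hj => ?_).trans
      (Finset.sum_le_sum_of_subset_of_nonneg (Finset.subset_univ (A ∩ W)) fun j _ _ =>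
        mul_nonneg (condProb_nonneg (uDist_nonneg _) A j) (h0 j _))
    obtain ⟨hjA, hjW⟩ := Finset.mem_inter.1 hj
    have hjU : j ∈ S ∪ W := Finset.mem_union_right _ hjW
    have hne : A ∩ (S ∪ W) ≠ ∅ := Finset.ne_empty_of_mem (Finset.mem_inter.2 ⟨hjA, hjU⟩)
    rw [condProb_uDist, if_pos hjA, if_neg hne, if_pos hjU, hcard]
    push_cast
    exact le_of_eq (by ring)
  have hX0 : 0 ≤ ∑ j ∈ A ∩ W, F j (S ∪ W) := Finset.sum_nonneg fun j _ => h0 j _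
  have hXN : ∑ j ∈ A ∩ W, F j (S ∪ W) ≤ (A ∩ W).card := by
    simpa using Finset.sum_le_sum fun j (_ : j ∈ A ∩ W) => h1 j (S ∪ W)
  exact inverse_weight_le hl0 hθ (Nat.cast_nonneg _) hS (Nat.cast_nonneg _) hX0 hXN hge

/-- If the unknown part of a query set is large, then the answer is most likely a uniformly drawn
element of the unknown part. -/
lemma abs_step_sub_of_large {S V A : Finset (Fin n)} {w : ℕ} (hSV : Disjoint S V)
    (hw : w + 1 ≤ V.card) (hAV : (A ∩ V).Nonempty) {θ lam : ℝ} (hθ : 0 < θ)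
    (hlam : lam = ((w + 1 : ℕ) : ℝ) * (A ∩ V).card / V.card) {F : Fin n → Finset (Fin n) → ℝ}
    (h0 : ∀ j U, 0 ≤ F j U) (h1 : ∀ j U, F j U ≤ 1) :
    |subsetAvg (w + 1) V (fun W => ∑ j, condProb (uDist (S ∪ W)) A j * F j (S ∪ W)) -
      (∑ j ∈ A ∩ V, subsetAvg w (V.erase j) (fun W => F j (insert j S ∪ W))) / (A ∩ V).card| ≤
      S.card / lam + (1 / (lam * θ) + θ) / 2 := by
  have hA : A.Nonempty := hAV.mono Finset.inter_subset_left
  have ha : ((A ∩ V).card : ℝ) ≠ 0 := by exact_mod_cast hAV.card_pos.ne'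
  have hF := step_of_large_le hSV hw hAV hθ hlam h0 h1
  have hG := step_of_large_le hSV hw hAV hθ hlam (F := fun j U => 1 - F j U)
    (fun j U => by linarith [h1 j U]) (fun j U => by linarith [h0 j U])
  have e1 : subsetAvg (w + 1) V
      (fun W => ∑ j, condProb (uDist (S ∪ W)) A j * (1 - F j (S ∪ W))) =
      1 - subsetAvg (w + 1) V (fun W => ∑ j, condProb (uDist (S ∪ W)) A j * F j (S ∪ W)) := by
    rw [← subsetAvg_const hw 1, ← subsetAvg_sub, subsetAvg_const hw]
    refine subsetAvg_congr fun W _ _ => ?_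
    simp_rw [mul_sub, mul_one]
    rw [Finset.sum_sub_distrib, sum_condProb _ hA]
  have e2 : (∑ j ∈ A ∩ V, subsetAvg w (V.erase j) (fun W => 1 - F j (insert j S ∪ W))) /
      (A ∩ V).card = 1 -
      (∑ j ∈ A ∩ V, subsetAvg w (V.erase j) (fun W => F j (insert j S ∪ W))) /
        (A ∩ V).card := by
    have : ∀ j ∈ A ∩ V, subsetAvg w (V.erase j) (fun W => 1 - F j (insert j S ∪ W)) =
        1 - subsetAvg w (V.erase j) (fun W => F j (insert j S ∪ W)) := by
      intro j hj
      have : w ≤ (V.erase j).card := by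
        rw [Finset.card_erase_of_mem (Finset.mem_inter.1 hj).2]; omega
      rw [subsetAvg_sub, subsetAvg_const this]
    rw [Finset.sum_congr rfl this, Finset.sum_sub_distrib, sub_div]
    simp [ha]
  rw [e1, e2] at hG
  rw [abs_le]
  constructor <;> linarith

end OneStep

lemma abs_sub_le_of_close {x y x' y' d e f : ℝ} (hx : |x - x'| ≤ d) (hy : |y - y'| ≤ e)
    (h : |x' - y'| ≤ f) : |x - y| ≤ d + e + f := by
  rw [abs_le] at *
  constructor <;> linarith [hx.1, hx.2, hy.1, hy.2, h.1, h.2]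

/-! ### Recursion over the queries for fixed coin tosses -/

section Adaptive

variable {n : ℕ}

lemma AdaptiveAlgorithm.outputProbFrom_nonneg (T : AdaptiveAlgorithm n) (c : T.Coins)
    {p : Fin n → ℝ} (hp : ∀ i, 0 ≤ p i) (b : Bool) (r : ℕ) (h : List (Fin n)) :
    0 ≤ T.outputProbFrom c p b r h := by
  induction r generalizing h with
  | zero => unfold outputProbFrom; split_ifs <;> norm_num
  | succ r ih => exact sum_condProb_mul_nonneg hp _ fun j => ih _

lemma AdaptiveAlgorithm.outputProbFrom_le_one (T : AdaptiveAlgorithm n) (c : T.Coins)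
    {p : Fin n → ℝ} (hp : ∀ i, 0 ≤ p i) (b : Bool) (r : ℕ) (h : List (Fin n)) :
    T.outputProbFrom c p b r h ≤ 1 := by
  induction r generalizing h with
  | zero => unfold outputProbFrom; split_ifs <;> norm_num
  | succ r ih => exact sum_condProb_mul_le_one hp (T.query c h).2 fun j => ih _

lemma AdaptiveAlgorithm.outputProbFrom_true_add_false (T : AdaptiveAlgorithm n) (c : T.Coins)
    (p : Fin n → ℝ) (r : ℕ) (h : List (Fin n)) :
    T.outputProbFrom c p true r h + T.outputProbFrom c p false r h = 1 := by
  induction r generalizing h with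
  | zero => unfold outputProbFrom; cases T.decision c h <;> simp
  | succ r ih =>
    unfold outputProbFrom
    rw [← Finset.sum_add_distrib, ← sum_condProb p (T.query c h).2]
    refine Finset.sum_congr rfl fun j _ => ?_
    rw [← mul_add, ih, mul_one]

/-- The average output probability over the supports of size `m` that consist of `S` and of
elements of `V`. -/
def supportAvg (T : AdaptiveAlgorithm n) (c : T.Coins) (b : Bool) (r : ℕ) (h : List (Fin n))
    (S V : Finset (Fin n)) (m : ℕ) : ℝ :=
  subsetAvg (m - S.card) V (fun W => T.outputProbFrom c (uDist (S ∪ W)) b r h)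

lemma abs_supportAvg_sub_le_one (T : AdaptiveAlgorithm n) (c : T.Coins) (b : Bool) (r : ℕ)
    (h : List (Fin n)) (S V : Finset (Fin n)) {m m' : ℕ} (hm : m ≤ V.card) (hm' : m' ≤ V.card) :
    |supportAvg T c b r h S V m - supportAvg T c b r h S V m'| ≤ 1 := by
  have nn (k : ℕ) : 0 ≤ supportAvg T c b r h S V k :=
    subsetAvg_nonneg fun W _ _ => T.outputProbFrom_nonneg c (uDist_nonneg _) b r h
  have le {k : ℕ} (hk : k ≤ V.card) : supportAvg T c b r h S V k ≤ 1 :=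
    subsetAvg_le_one (by omega) fun W _ _ => T.outputProbFrom_le_one c (uDist_nonneg _) b r h
  have := nn m; have := nn m'; have := le hm; have := le hm'
  rw [abs_le]; constructor <;> linarith

/-- The chance that `W` meets the query is at most `a * m / |V| ≤ 2 / 4 ^ q`; the weaker `4 / 2 ^ q`
matches the large case. -/
lemma supportAvg_step_of_small (T : AdaptiveAlgorithm n) (c : T.Coins) (b : Bool) (r : ℕ)
    (h : List (Fin n)) {S V : Finset (Fin n)} {m q : ℕ} (hV : n ≤ 2 * V.card)
    (hm : m ≤ (V \ (T.query c h).1).card)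
    (hsmall : ((T.query c h).1 ∩ V).card * m * 4 ^ q ≤ n) :
    |supportAvg T c b (r + 1) h S V m - ∑ j, condProb (uDist S) (T.query c h).1 j *
      supportAvg T c b r (h ++ [j]) S (V \ (T.query c h).1) m| ≤ 4 / 2 ^ q := by
  refine (abs_step_sub_of_small (T.query c h).2 ((Nat.sub_le _ _).trans hm)
    (F := fun j U => T.outputProbFrom c (uDist U) b r (h ++ [j]))
    (fun j U => T.outputProbFrom_nonneg c (uDist_nonneg _) b r _)
    (fun j U => T.outputProbFrom_le_one c (uDist_nonneg _) b r _)).trans ?_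
  rcases Nat.eq_zero_or_pos V.card with h0 | h0
  · simp only [h0, Nat.cast_zero, div_zero]; positivity
  have hv : (0 : ℝ) < V.card := by exact_mod_cast h0
  rw [div_le_div_iff₀ hv (by positivity)]
  have h4 : (2 : ℕ) ^ q ≤ 4 ^ q := Nat.pow_le_pow_left (by norm_num) q
  have : (m - S.card) * ((T.query c h).1 ∩ V).card * 2 ^ q ≤ 4 * V.card := by
    calc (m - S.card) * ((T.query c h).1 ∩ V).card * 2 ^ q
        ≤ m * ((T.query c h).1 ∩ V).card * 4 ^ q := by gcongr; omega
      _ = ((T.query c h).1 ∩ V).card * m * 4 ^ q := by ring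
      _ ≤ 4 * V.card := by omega
  exact_mod_cast this

/-- As `|S| < q ≤ m / 2`, at least half of the support is still unknown, so the expected hit count
is at least `4 ^ q / 2`. Taking `θ = 2 ^ (-q)` makes every error term of order `2 ^ (-q)`. -/
lemma supportAvg_step_of_large (T : AdaptiveAlgorithm n) (c : T.Coins) (b : Bool) (r : ℕ)
    (h : List (Fin n)) {S V : Finset (Fin n)} {m q : ℕ} (hn : 0 < n) (hSV : Disjoint S V)
    (hS : S.card < q) (hm : m ≤ V.card) (hqm : 2 * q ≤ m)
    (hlarge : 4 ^ q * n ≤ ((T.query c h).1 ∩ V).card * m) :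
    |supportAvg T c b (r + 1) h S V m - (∑ j ∈ (T.query c h).1 ∩ V,
      supportAvg T c b r (h ++ [j]) (insert j S) (V.erase j) m) /
        ((T.query c h).1 ∩ V).card| ≤ 4 / 2 ^ q := by
  have hAV : ((T.query c h).1 ∩ V).Nonempty := by
    rw [← Finset.card_pos]
    refine Nat.pos_of_ne_zero fun h0 => ?_
    rw [h0, zero_mul] at hlarge
    have : 0 < 4 ^ q * n := by positivity
    omega
  obtain ⟨w, hw⟩ : ∃ w, m - S.card = w + 1 := ⟨m - S.card - 1, by omega⟩
  have hVn : V.card ≤ n := by simpa using Finset.card_le_univ V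
  have h2q : (0 : ℝ) < 2 ^ q := by positivity
  have key := abs_step_sub_of_large hSV (w := w) (by omega) hAV
    (θ := 1 / 2 ^ q) (by positivity) rfl
    (F := fun j U => T.outputProbFrom c (uDist U) b r (h ++ [j]))
    (fun j U => T.outputProbFrom_nonneg c (uDist_nonneg _) b r _)
    (fun j U => T.outputProbFrom_le_one c (uDist_nonneg _) b r _)
  have e : ∑ j ∈ (T.query c h).1 ∩ V,
      supportAvg T c b r (h ++ [j]) (insert j S) (V.erase j) m =
      ∑ j ∈ (T.query c h).1 ∩ V, subsetAvg w (V.erase j)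
        (fun W => T.outputProbFrom c (uDist (insert j S ∪ W)) b r (h ++ [j])) := by
    refine Finset.sum_congr rfl fun j hj => ?_
    have hjS : j ∉ S := Finset.disjoint_right.1 hSV (Finset.mem_inter.1 hj).2
    unfold supportAvg
    rw [Finset.card_insert_of_notMem hjS]
    congr 1; omega
  have e' : supportAvg T c b (r + 1) h S V m = subsetAvg (w + 1) V (fun W =>
      ∑ j, condProb (uDist (S ∪ W)) (T.query c h).1 j *
        T.outputProbFrom c (uDist (S ∪ W)) b r (h ++ [j])) := by
    unfold supportAvg; rw [hw]; rfl
  rw [e, e']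
  refine key.trans ?_
  set lam : ℝ := ((w + 1 : ℕ) : ℝ) * ((T.query c h).1 ∩ V).card / V.card with hlam
  have hv : (0 : ℝ) < V.card := by exact_mod_cast (by omega : 0 < V.card)
  have hl : (2 ^ q : ℝ) ^ 2 / 2 ≤ lam := by
    rw [hlam, div_le_div_iff₀ (by norm_num) hv]
    have : (2 ^ q) ^ 2 * V.card ≤ (w + 1) * ((T.query c h).1 ∩ V).card * 2 := by
      calc (2 ^ q) ^ 2 * V.card ≤ 4 ^ q * n := by
            rw [← pow_mul, mul_comm q 2, pow_mul]; norm_num; gcongr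
        _ ≤ ((T.query c h).1 ∩ V).card * m := hlarge
        _ ≤ ((T.query c h).1 ∩ V).card * ((w + 1) * 2) := by gcongr; omega
        _ = _ := by ring
    exact_mod_cast this
  have hSq : (S.card : ℝ) ≤ 2 ^ q := by
    exact_mod_cast (hS.le.trans Nat.lt_two_pow_self.le)
  have hl0 : 0 < lam := lt_of_lt_of_le (by positivity) hl
  have b1 : (S.card : ℝ) / lam ≤ 2 / 2 ^ q := by
    rw [div_le_div_iff₀ hl0 h2q]; nlinarith
  have b2 : 1 / (lam * (1 / 2 ^ q)) ≤ 2 / 2 ^ q := by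
    rw [div_le_div_iff₀ (by positivity) h2q, mul_one_div, mul_div_assoc', le_div_iff₀ h2q]
    nlinarith
  have b3 : 4 / (2 : ℝ) ^ q = 2 / 2 ^ q + 1 / 2 ^ q + 1 / 2 ^ q := by ring
  have : (2 : ℝ) / 2 ^ q = 1 / 2 ^ q + 1 / 2 ^ q := by ring
  have : (0 : ℝ) < 1 / 2 ^ q := by positivity
  linarith

/-- A set of a given size is of intermediate size for few exponents only. -/
lemma card_filter_intermediate_le (K : Finset ℕ) (a n q : ℕ) :
    (K.filter fun k => ¬ 4 ^ q * n ≤ a * 2 ^ (2 * k) ∧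
      ¬ a * 2 ^ (2 * k + 1) * 4 ^ q ≤ n).card ≤ 2 * q + 1 := by
  set C := K.filter fun k => ¬ 4 ^ q * n ≤ a * 2 ^ (2 * k) ∧
      ¬ a * 2 ^ (2 * k + 1) * 4 ^ q ≤ n with hC
  rcases C.eq_empty_or_nonempty with h | h
  · simp [h]
  have hsub : C ⊆ Finset.Icc (C.min' h) (C.min' h + 2 * q) := by
    intro k hk
    rw [Finset.mem_Icc]
    refine ⟨Finset.min'_le _ _ hk, ?_⟩
    have h1 := (Finset.mem_filter.1 hk).2.1
    have h2 := (Finset.mem_filter.1 (Finset.min'_mem C h)).2.2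
    generalize C.min' h = k' at *
    push Not at h1 h2
    -- For the least intermediate exponent `k'` and any other `k`, eliminating `n` from the two
    -- failed thresholds gives `2k < 4q + 2k' + 1`.
    have h3 : a * 2 ^ (2 * k) < a * 2 ^ (4 * q + 2 * k' + 1) := by
      calc a * 2 ^ (2 * k) < 4 ^ q * n := h1
        _ ≤ 4 ^ q * (a * 2 ^ (2 * k' + 1) * 4 ^ q) := by gcongr
        _ = a * 2 ^ (4 * q + 2 * k' + 1) := by
          rw [show (4 : ℕ) = 2 ^ 2 by norm_num, ← pow_mul]; ring_nf
    have h4 := (Nat.pow_lt_pow_iff_right (by norm_num : 1 < 2)).1 (Nat.lt_of_mul_lt_mul_left h3)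
    omega
  refine (Finset.card_le_card hsub).trans ?_
  simp only [Nat.card_Icc]; omega

/-- The main estimate: summed over the exponents, the even and the odd output probabilities differ
by a bounded number of exponents for each node of a binary tree, up to a small error. -/
lemma sum_abs_supportAvg_sub_le (T : AdaptiveAlgorithm n) (c : T.Coins) (b : Bool) {q : ℕ}
    (hn : 4 ^ q ≤ n) (r : ℕ) (h : List (Fin n)) (S V : Finset (Fin n)) (K : Finset ℕ)
    (hSV : Disjoint S V) (hS : S.card + r ≤ q)
    (hV : 4 ^ q * n + 2 * r * n ≤ 2 * 4 ^ q * V.card)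
    (hK : ∀ k ∈ K, 2 * q ≤ 2 ^ (2 * k) ∧ 2 * 2 ^ (2 * k + 1) ≤ n) :
    ∑ k ∈ K, |supportAvg T c b r h S V (2 ^ (2 * k)) -
      supportAvg T c b r h S V (2 ^ (2 * k + 1))| ≤
      (2 ^ r - 1) * (2 * q + 1) + K.card * (r * (8 / 2 ^ q)) := by
  have hn0 : 0 < n := lt_of_lt_of_le (by positivity) hn
  induction r generalizing h S V K with
  | zero =>
    have hV2 : n ≤ 2 * V.card := by
      have : 4 ^ q * n ≤ 4 ^ q * (2 * V.card) := by linarith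
      exact Nat.le_of_mul_le_mul_left this (by positivity)
    rw [Finset.sum_eq_zero]
    · simp
    · intro k hk
      have := (hK k hk).2
      have h2 : (2 : ℕ) ^ (2 * k + 1) = 2 * 2 ^ (2 * k) := by ring
      unfold supportAvg AdaptiveAlgorithm.outputProbFrom
      rw [subsetAvg_const (by omega), subsetAvg_const (by omega), sub_self, abs_zero]
  | succ r ih =>
    -- Hypothesis `hV` reads `|V| ≥ n / 2 + (r + 1) * n / 4 ^ q`: each query may remove `n / 4 ^ q`
    -- elements, and half of the domain always stays unknown.
    have hbranch : ∀ V' : Finset (Fin n), 4 ^ q * n + 2 * r * n ≤ 2 * 4 ^ q * V'.card →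
        n ≤ 2 * V'.card := by
      intro V' hV'
      have : 4 ^ q * n ≤ 4 ^ q * (2 * V'.card) := by
        have := Nat.zero_le (2 * r * n)
        linarith
      exact Nat.le_of_mul_le_mul_left this (by positivity)
    have hV2 : n ≤ 2 * V.card := hbranch V (by nlinarith)
    have hle : ∀ k ∈ K, 2 ^ (2 * k) ≤ 2 ^ (2 * k + 1) ∧ 2 * 2 ^ (2 * k + 1) ≤ n :=
      fun k hk => ⟨Nat.pow_le_pow_right (by norm_num) (by omega), (hK k hk).2⟩
    set A := (T.query c h).1 with hA
    set a := (A ∩ V).card with ha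
    set D : ℕ → ℝ := fun k => |supportAvg T c b (r + 1) h S V (2 ^ (2 * k)) -
      supportAvg T c b (r + 1) h S V (2 ^ (2 * k + 1))| with hD
    -- The large regime is tested at the even size and the small one at the odd size, so each
    -- condition holds for both sizes of a pair.
    set Kl := K.filter fun k => 4 ^ q * n ≤ a * 2 ^ (2 * k) with hKl
    set Kr := K.filter fun k => ¬ 4 ^ q * n ≤ a * 2 ^ (2 * k) with hKr
    set Ks := Kr.filter fun k => a * 2 ^ (2 * k + 1) * 4 ^ q ≤ n with hKs
    set Kc := Kr.filter fun k => ¬ a * 2 ^ (2 * k + 1) * 4 ^ q ≤ n with hKc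
    have hsum : ∑ k ∈ K, D k = ∑ k ∈ Kl, D k + (∑ k ∈ Ks, D k + ∑ k ∈ Kc, D k) := by
      rw [hKs, hKc, Finset.sum_filter_add_sum_filter_not, hKl, hKr,
        Finset.sum_filter_add_sum_filter_not]
    have hcard : K.card = Kl.card + (Ks.card + Kc.card) := by
      rw [hKs, hKc, Finset.card_filter_add_card_filter_not, hKl, hKr,
        Finset.card_filter_add_card_filter_not]
    have hpow : (0 : ℝ) ≤ (2 ^ r - 1) * (2 * q + 1) := by
      have : (1 : ℝ) ≤ 2 ^ r := one_le_pow₀ (by norm_num)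
      have := sub_nonneg.2 this
      positivity
    have hc : ∑ k ∈ Kc, D k ≤ 2 * q + 1 := by
      have h1 : ∑ k ∈ Kc, D k ≤ ∑ k ∈ Kc, (1 : ℝ) := by
        refine Finset.sum_le_sum fun k hk => ?_
        obtain ⟨h1, h2⟩ := hle k (Finset.mem_filter.1 (Finset.mem_filter.1 hk).1).1
        exact abs_supportAvg_sub_le_one T c b (r + 1) h S V (by omega) (by omega)
      have h2 : Kc.card ≤ 2 * q + 1 := by
        rw [hKc, hKr, Finset.filter_filter]
        exact card_filter_intermediate_le K a n q
      have h3 : (Kc.card : ℝ) ≤ 2 * q + 1 := by exact_mod_cast h2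
      simp only [Finset.sum_const, nsmul_eq_mul, mul_one] at h1
      linarith
    have hl : ∑ k ∈ Kl, D k ≤
        (2 ^ r - 1) * (2 * q + 1) + Kl.card * ((r + 1) * (8 / 2 ^ q)) := by
      rcases Kl.eq_empty_or_nonempty with h0 | ⟨k₀, hk₀⟩
      · simpa [h0] using hpow
      have ha0 : 0 < a := by
        refine Nat.pos_of_ne_zero fun h0 => ?_
        have := (Finset.mem_filter.1 hk₀).2
        rw [h0, zero_mul] at this
        have : 0 < 4 ^ q * n := by positivity
        omega
      have ha' : (0 : ℝ) < a := by exact_mod_cast ha0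
      have hstep : ∀ k ∈ Kl, D k ≤ 8 / 2 ^ q + (∑ j ∈ A ∩ V,
          |supportAvg T c b r (h ++ [j]) (insert j S) (V.erase j) (2 ^ (2 * k)) -
            supportAvg T c b r (h ++ [j]) (insert j S) (V.erase j) (2 ^ (2 * k + 1))|) / a := by
        intro k hk
        obtain ⟨hkK, hk1⟩ := Finset.mem_filter.1 hk
        obtain ⟨h1, h2⟩ := hle k hkK
        have s1 := supportAvg_step_of_large T c b r h hn0 hSV (m := 2 ^ (2 * k)) (q := q)
          (by omega) (by omega) (hK k hkK).1 hk1
        have s2 := supportAvg_step_of_large T c b r h hn0 hSV (m := 2 ^ (2 * k + 1)) (q := q)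
          (by omega) (by omega) ((hK k hkK).1.trans h1) (hk1.trans (by gcongr))
        rw [← hA, ← ha] at s1 s2
        have s3 := Finset.abs_sum_le_sum_abs (fun j =>
          supportAvg T c b r (h ++ [j]) (insert j S) (V.erase j) (2 ^ (2 * k)) -
            supportAvg T c b r (h ++ [j]) (insert j S) (V.erase j) (2 ^ (2 * k + 1))) (A ∩ V)
        have s4 := div_le_div_of_nonneg_right s3 ha'.le
        rw [Finset.sum_sub_distrib, ← abs_of_pos ha', ← abs_div, abs_of_pos ha', sub_div] at s4
        have e8 : (8 : ℝ) / 2 ^ q = 4 / 2 ^ q + 4 / 2 ^ q := by ring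
        rw [e8]
        exact abs_sub_le_of_close s1 s2 s4
      have hrec : ∀ j ∈ A ∩ V, ∑ k ∈ Kl,
          |supportAvg T c b r (h ++ [j]) (insert j S) (V.erase j) (2 ^ (2 * k)) -
            supportAvg T c b r (h ++ [j]) (insert j S) (V.erase j) (2 ^ (2 * k + 1))| ≤
          (2 ^ r - 1) * (2 * q + 1) + Kl.card * (r * (8 / 2 ^ q)) := by
        intro j hj
        have hjV := (Finset.mem_inter.1 hj).2
        have hjS : j ∉ S := Finset.disjoint_right.1 hSV hjV
        refine ih (h ++ [j]) (insert j S) (V.erase j) Kl ?_ ?_ ?_ ?_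
        · rw [Finset.disjoint_insert_left]
          exact ⟨by simp, hSV.mono_right (Finset.erase_subset _ _)⟩
        · rw [Finset.card_insert_of_notMem hjS]; omega
        -- Removing one element fits the allowance because `4 ^ q ≤ n`.
        · have : (V.erase j).card + 1 = V.card := Finset.card_erase_add_one hjV
          rw [← this] at hV
          nlinarith
        · exact fun k hk => hK k (Finset.mem_filter.1 hk).1
      calc ∑ k ∈ Kl, D k ≤ _ := Finset.sum_le_sum hstep
        _ = Kl.card * (8 / 2 ^ q) + (∑ j ∈ A ∩ V, ∑ k ∈ Kl,
          |supportAvg T c b r (h ++ [j]) (insert j S) (V.erase j) (2 ^ (2 * k)) -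
            supportAvg T c b r (h ++ [j]) (insert j S) (V.erase j) (2 ^ (2 * k + 1))|) / a := by
          rw [Finset.sum_add_distrib, Finset.sum_comm, Finset.sum_div]; simp
        _ ≤ Kl.card * (8 / 2 ^ q) + (∑ j ∈ A ∩ V,
            ((2 ^ r - 1 : ℝ) * (2 * q + 1) + Kl.card * (r * (8 / 2 ^ q)))) / a := by
          gcongr with j hj; exact hrec j hj
        _ = _ := by
          rw [Finset.sum_const, nsmul_eq_mul, ← ha]; field_simp; ring
    have hs : ∑ k ∈ Ks, D k ≤
        (2 ^ r - 1) * (2 * q + 1) + Ks.card * ((r + 1) * (8 / 2 ^ q)) := by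
      rcases Ks.eq_empty_or_nonempty with h0 | ⟨k₀, hk₀⟩
      · simpa [h0] using hpow
      -- Any exponent in the small class certifies that deleting `A` costs `V` at most `n / 4 ^ q`
      -- elements.
      have haq : a * 4 ^ q ≤ n := by
        refine le_trans ?_ (Finset.mem_filter.1 hk₀).2
        gcongr
        exact Nat.le_mul_of_pos_right _ (by positivity)
      have hV' : 4 ^ q * n + 2 * r * n ≤ 2 * 4 ^ q * (V \ A).card := by
        have : (V \ A).card + a = V.card := by
          rw [ha, Finset.inter_comm]; exact Finset.card_sdiff_add_card_inter V A
        rw [← this] at hV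
        nlinarith
      have hVA := hbranch _ hV'
      have hstep : ∀ k ∈ Ks, D k ≤ 8 / 2 ^ q + ∑ j, condProb (uDist S) A j *
          |supportAvg T c b r (h ++ [j]) S (V \ A) (2 ^ (2 * k)) -
            supportAvg T c b r (h ++ [j]) S (V \ A) (2 ^ (2 * k + 1))| := by
        intro k hk
        obtain ⟨hkr, hk1⟩ := Finset.mem_filter.1 hk
        obtain ⟨h1, h2⟩ := hle k (Finset.mem_filter.1 hkr).1
        have s1 := supportAvg_step_of_small T c b r h (S := S) hV2 (m := 2 ^ (2 * k)) (q := q)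
          (by rw [← hA]; omega) (le_trans (by gcongr) hk1)
        have s2 := supportAvg_step_of_small T c b r h (S := S) hV2 (m := 2 ^ (2 * k + 1)) (q := q)
          (by rw [← hA]; omega) hk1
        rw [← hA] at s1 s2
        have e8 : (8 : ℝ) / 2 ^ q = 4 / 2 ^ q + 4 / 2 ^ q := by ring
        rw [e8]
        refine abs_sub_le_of_close s1 s2 ?_
        rw [← Finset.sum_sub_distrib]
        refine (Finset.abs_sum_le_sum_abs _ _).trans (Finset.sum_le_sum fun j _ => ?_)
        rw [← mul_sub, abs_mul, abs_of_nonneg (condProb_nonneg (uDist_nonneg S) A j)]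
      have hrec : ∀ j, ∑ k ∈ Ks,
          |supportAvg T c b r (h ++ [j]) S (V \ A) (2 ^ (2 * k)) -
            supportAvg T c b r (h ++ [j]) S (V \ A) (2 ^ (2 * k + 1))| ≤
          (2 ^ r - 1) * (2 * q + 1) + Ks.card * (r * (8 / 2 ^ q)) := fun j =>
        ih (h ++ [j]) S (V \ A) Ks (hSV.mono_right Finset.sdiff_subset) (by omega) hV'
          fun k hk => hK k (Finset.mem_filter.1 (Finset.mem_filter.1 hk).1).1
      calc ∑ k ∈ Ks, D k ≤ _ := Finset.sum_le_sum hstep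
        _ = Ks.card * (8 / 2 ^ q) + ∑ j, condProb (uDist S) A j * ∑ k ∈ Ks,
          |supportAvg T c b r (h ++ [j]) S (V \ A) (2 ^ (2 * k)) -
            supportAvg T c b r (h ++ [j]) S (V \ A) (2 ^ (2 * k + 1))| := by
          rw [Finset.sum_add_distrib, Finset.sum_comm]; simp [Finset.mul_sum]
        _ ≤ Ks.card * (8 / 2 ^ q) + ∑ j, condProb (uDist S) A j *
            ((2 ^ r - 1) * (2 * q + 1) + Ks.card * (r * (8 / 2 ^ q))) := by
          gcongr with j hj
          · exact condProb_nonneg (uDist_nonneg S) A j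
          · exact hrec j
        _ = _ := by
          rw [← Finset.sum_mul, sum_condProb _ (T.query c h).2]; ring
    have hKc0 : (0 : ℝ) ≤ Kc.card * ((r + 1) * (8 / 2 ^ q)) := by positivity
    have hcard' : (K.card : ℝ) = Kl.card + (Ks.card + Kc.card) := by exact_mod_cast hcard
    -- Two subtrees and the current node: `2 * (2 ^ r - 1) + 1 = 2 ^ (r + 1) - 1`.
    rw [hsum, hcard', pow_succ]
    push_cast
    linarith

end Adaptive

/-! ### Averaging over the coin tosses -/

section Integration

variable {n : ℕ}

lemma AdaptiveAlgorithm.measurable_outputProbFrom (T : AdaptiveAlgorithm n) (p : Fin n → ℝ)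
    (b : Bool) (r : ℕ) (h : List (Fin n)) :
    Measurable fun c => T.outputProbFrom c p b r h := by
  induction r generalizing h with
  | zero =>
    unfold outputProbFrom
    exact Measurable.ite (T.measurable_decision h b) measurable_const measurable_const
  | succ r ih =>
    unfold outputProbFrom
    refine Finset.measurable_sum _ fun j _ => Measurable.mul ?_ (ih _)
    -- There are finitely many query sets, so measurability of the fibres suffices for the discrete
    -- σ-algebra.
    let _ : MeasurableSpace (QuerySet n) := ⊤
    have hq : Measurable fun c => T.query c h :=
      measurable_to_countable' fun A => T.measurable_query h A
    exact (measurable_from_top (f := fun A : QuerySet n => condProb p A.1 j)).comp hq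

lemma AdaptiveAlgorithm.integrable_outputProbFrom (T : AdaptiveAlgorithm n) {p : Fin n → ℝ}
    (hp : ∀ i, 0 ≤ p i) (b : Bool) (r : ℕ) (h : List (Fin n)) :
    Integrable (fun c => T.outputProbFrom c p b r h) T.coinLaw := by
  refine Integrable.of_bound (T.measurable_outputProbFrom p b r h).aestronglyMeasurable 1
    (Filter.Eventually.of_forall fun c => ?_)
  rw [Real.norm_of_nonneg (T.outputProbFrom_nonneg c hp b r h)]
  exact T.outputProbFrom_le_one c hp b r h

lemma AdaptiveAlgorithm.outputProb_true_add_false (T : AdaptiveAlgorithm n) (t : ℕ)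
    {p : Fin n → ℝ} (hp : ∀ i, 0 ≤ p i) :
    T.outputProb t p true + T.outputProb t p false = 1 := by
  unfold outputProb
  rw [← integral_add (T.integrable_outputProbFrom hp true t [])
    (T.integrable_outputProbFrom hp false t [])]
  simp [T.outputProbFrom_true_add_false]

lemma uniblockExpect_eq_subsetAvg (s n : ℕ) (f : (Fin n → ℝ) → ℝ) :
    uniblockExpect s n f = (∑ k ∈ blockExponents n,
      subsetAvg (2 ^ (2 * k + s)) Finset.univ fun U => f (uDist U)) / (blockExponents n).card := by
  simp [uniblockExpect, subsetAvg, Finset.card_powersetCard]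

lemma uniblockExpect_const {s n : ℕ} (hB : (blockExponents n).Nonempty)
    (hs : ∀ k ∈ blockExponents n, 2 ^ (2 * k + s) ≤ n) (a : ℝ) :
    uniblockExpect s n (fun _ => a) = a := by
  have : ((blockExponents n).card : ℝ) ≠ 0 := by exact_mod_cast hB.card_pos.ne'
  rw [uniblockExpect_eq_subsetAvg, Finset.sum_congr rfl (g := fun _ => a)]
  · simp [this]
  · intro k hk
    exact subsetAvg_const (by simpa using hs k hk) a

lemma uniblockExpect_mono {s n : ℕ} {f g : (Fin n → ℝ) → ℝ}
    (h : ∀ k ∈ blockExponents n, ∀ U : Finset (Fin n), U.card = 2 ^ (2 * k + s) →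
      f (uDist U) ≤ g (uDist U)) : uniblockExpect s n f ≤ uniblockExpect s n g := by
  rw [uniblockExpect_eq_subsetAvg, uniblockExpect_eq_subsetAvg]
  gcongr with k hk
  exact subsetAvg_mono fun U _ hU => h k hk U hU

lemma uniblockExpect_outputProb (T : AdaptiveAlgorithm n) (s t : ℕ) (b : Bool) :
    uniblockExpect s n (fun p => T.outputProb t p b) =
      ∫ c, uniblockExpect s n (fun p => T.outputProbFrom c p b t []) ∂T.coinLaw := by
  unfold uniblockExpect AdaptiveAlgorithm.outputProb
  have hi := fun U : Finset (Fin n) => T.integrable_outputProbFrom (uDist_nonneg U) b t []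
  rw [integral_div, integral_finsetSum]
  · congr 1
    refine Finset.sum_congr rfl fun k _ => ?_
    rw [integral_div, integral_finsetSum _ fun U _ => hi U]
  · exact fun k _ => (integrable_finsetSum _ fun U _ => hi U).div_const _

lemma integrable_uniblockExpect_outputProbFrom (T : AdaptiveAlgorithm n) (s t : ℕ) (b : Bool) :
    Integrable (fun c => uniblockExpect s n (fun p => T.outputProbFrom c p b t [])) T.coinLaw :=
  (integrable_finsetSum _ fun _ _ => (integrable_finsetSum _ fun U _ =>
    T.integrable_outputProbFrom (uDist_nonneg U) b t []).div_const _).div_const _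

lemma abs_uniblockExpect_outputProbFrom_sub_le (T : AdaptiveAlgorithm n) (c : T.Coins) (b : Bool)
    {q t : ℕ} (hn : 4 ^ q ≤ n) (ht : t ≤ q) (hB : (blockExponents n).Nonempty)
    (hK : ∀ k ∈ blockExponents n, 2 * q ≤ 2 ^ (2 * k) ∧ 2 * 2 ^ (2 * k + 1) ≤ n) :
    |uniblockExpect 0 n (fun p => T.outputProbFrom c p b t []) -
      uniblockExpect 1 n (fun p => T.outputProbFrom c p b t [])| ≤
      (2 ^ t - 1) * (2 * q + 1) / (blockExponents n).card + t * (8 / 2 ^ q) := by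
  have hB0 : (0 : ℝ) < (blockExponents n).card := by exact_mod_cast hB.card_pos
  have key := sum_abs_supportAvg_sub_le T c b hn t [] ∅ Finset.univ (blockExponents n)
    (Finset.disjoint_empty_left _) (by simpa using ht) (by
      -- Since `2t ≤ 2q < 4 ^ q`, the full domain `V` has enough room for `t` queries.
      have h1 : 2 * q < 4 ^ q := by
        rw [show (4 : ℕ) = 2 ^ 2 by norm_num, ← pow_mul]; exact Nat.lt_two_pow_self
      have h2 : 2 * t * n ≤ 4 ^ q * n := by gcongr; omega
      rw [Finset.card_univ, Fintype.card_fin]; linarith) hK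
  have e : ∀ m, supportAvg T c b t [] ∅ Finset.univ m =
      subsetAvg m Finset.univ fun U => T.outputProbFrom c (uDist U) b t [] := by
    intro m; simp [supportAvg]
  simp only [e] at key
  rw [uniblockExpect_eq_subsetAvg, uniblockExpect_eq_subsetAvg, ← sub_div, abs_div,
    abs_of_pos hB0, div_le_iff₀ hB0, ← Finset.sum_sub_distrib]
  refine (Finset.abs_sum_le_sum_abs _ _).trans (key.trans_eq ?_)
  field_simp

lemma abs_uniblockExpect_outputProb_sub_le (T : AdaptiveAlgorithm n) (b : Bool)
    {q t : ℕ} (hn : 4 ^ q ≤ n) (ht : t ≤ q) (hB : (blockExponents n).Nonempty)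
    (hK : ∀ k ∈ blockExponents n, 2 * q ≤ 2 ^ (2 * k) ∧ 2 * 2 ^ (2 * k + 1) ≤ n) :
    |uniblockExpect 0 n (fun p => T.outputProb t p b) -
      uniblockExpect 1 n (fun p => T.outputProb t p b)| ≤
      (2 ^ t - 1) * (2 * q + 1) / (blockExponents n).card + t * (8 / 2 ^ q) := by
  rw [uniblockExpect_outputProb, uniblockExpect_outputProb,
    ← integral_sub (integrable_uniblockExpect_outputProbFrom T 0 t b)
      (integrable_uniblockExpect_outputProbFrom T 1 t b), ← Real.norm_eq_abs]
  refine (norm_integral_le_of_norm_le_const (Filter.Eventually.of_forall fun c =>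
    abs_uniblockExpect_outputProbFrom_sub_le T c b hn ht hB hK)).trans_eq ?_
  simp

end Integration

/-! ### Choice of the precision `q` in terms of `n` -/

section Asymptotics

open Filter Topology

lemma eventually_logb_le_div_four : ∀ᶠ x : ℝ in atTop, Real.logb 2 x ≤ x / 4 := by
  have h2 : 0 < Real.log 2 := Real.log_pos (by norm_num)
  filter_upwards [Real.isLittleO_log_id_atTop.bound (by positivity : 0 < Real.log 2 / 4),
    eventually_ge_atTop 0] with x hx hx0
  rw [Real.logb, div_le_iff₀ h2]
  have h1 := (le_abs_self _).trans hx
  rw [id, Real.norm_of_nonneg hx0] at h1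
  linarith

lemma tendsto_linear_div_two_pow :
    Tendsto (fun q : ℕ => (24 * q + 8 : ℝ) / 2 ^ q) atTop (𝓝 0) := by
  have h1 := tendsto_pow_const_div_const_pow_of_one_lt 1 (by norm_num : (1 : ℝ) < 2)
  have h0 := tendsto_pow_const_div_const_pow_of_one_lt 0 (by norm_num : (1 : ℝ) < 2)
  have := (h1.const_mul 24).add (h0.const_mul 8)
  simp only [mul_zero, add_zero] at this
  refine this.congr fun q => ?_
  simp; ring

/-- The choice is `q = ⌊(log log n) / 2⌋`. It makes `4 ^ q ≤ log n`, while about `(log n) / 4`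
exponents are available; `(24q + 8) / 2 ^ q` is the total error when `t ≤ q`. -/
lemma eventually_exists_depth {η : ℝ} (hη : 0 < η) :
    ∃ N : ℕ, ∀ n : ℕ, N ≤ n → ∃ q : ℕ, 4 ^ q ≤ n ∧
      (∀ t : ℕ, (t : ℝ) ≤ Real.sqrt (Real.logb 2 (Real.logb 2 n) / 32) → t ≤ q) ∧
      (∀ k ∈ blockExponents n, 2 * q ≤ 2 ^ (2 * k) ∧ 2 * 2 ^ (2 * k + 1) ≤ n) ∧
      4 ^ q ≤ 8 * (blockExponents n).card ∧ (24 * q + 8 : ℝ) / 2 ^ q ≤ η := by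
  have hlog : Tendsto (Real.logb 2) atTop atTop := Real.tendsto_logb_atTop (by norm_num)
  have hx : Tendsto (fun n : ℕ => Real.logb 2 n) atTop atTop :=
    hlog.comp tendsto_natCast_atTop_atTop
  have hT : Tendsto (fun n : ℕ => Real.logb 2 (Real.logb 2 n)) atTop atTop := hlog.comp hx
  have hq : Tendsto (fun n : ℕ => ⌊Real.logb 2 (Real.logb 2 n) / 2⌋₊) atTop atTop :=
    tendsto_nat_floor_atTop.comp (hT.atTop_div_const (by norm_num))
  have hev := (tendsto_linear_div_two_pow.comp hq).eventually (ge_mem_nhds hη)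
  rw [← eventually_atTop]
  filter_upwards [hx.eventually_ge_atTop 16, hT.eventually_ge_atTop 1,
    hx.eventually eventually_logb_le_div_four, hev, eventually_gt_atTop 0] with n h16 hT1 hTx hη' hn
  refine ⟨⌊Real.logb 2 (Real.logb 2 n) / 2⌋₊, ?_⟩
  unfold blockExponents
  simp only [Function.comp_apply] at hη'
  have hnx : (2 : ℝ) ^ Real.logb 2 n = n :=
    Real.rpow_logb (by norm_num) (by norm_num) (by exact_mod_cast hn)
  set x := Real.logb 2 n with hxdef
  have hTt : (2 : ℝ) ^ Real.logb 2 x = x :=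
    Real.rpow_logb (by norm_num) (by norm_num) (by linarith)
  set τ := Real.logb 2 x with hτ
  set q := ⌊τ / 2⌋₊ with hqdef
  have hqτ : (q : ℝ) ≤ τ / 2 := Nat.floor_le (by linarith)
  have h4q : (4 : ℝ) ^ q ≤ x := by
    calc (4 : ℝ) ^ q = (2 : ℝ) ^ ((2 * q : ℕ) : ℝ) := by
          rw [Real.rpow_natCast, pow_mul]; norm_num
      _ ≤ (2 : ℝ) ^ τ := by
          apply Real.rpow_le_rpow_of_exponent_le (by norm_num); push_cast; linarith
      _ = x := hTt
  refine ⟨?_, ?_, ?_, ?_, hη'⟩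
  · have : x ≤ n := by
      rw [← hnx]
      have h1 := Nat.lt_floor_add_one x
      have h2 : ((⌊x⌋₊ + 1 : ℕ) : ℝ) ≤ 2 ^ ⌊x⌋₊ := by exact_mod_cast Nat.lt_two_pow_self
      have h3 : (2 : ℝ) ^ (⌊x⌋₊ : ℝ) ≤ 2 ^ x :=
        Real.rpow_le_rpow_of_exponent_le (by norm_num) (Nat.floor_le (by linarith))
      rw [Real.rpow_natCast] at h3
      push_cast at h2
      linarith
    exact_mod_cast h4q.trans this
  · intro t ht
    refine Nat.le_floor (ht.trans ?_)
    -- `√(τ / 32) ≤ τ / 2` because `τ ≥ 1`.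
    rw [Real.sqrt_le_left (by linarith)]
    nlinarith
  · intro k hk
    rw [Finset.mem_Icc, Nat.ceil_le, Nat.le_floor_iff (by linarith)] at hk
    constructor
    · have h1 : 2 * k < 2 ^ (2 * k) := Nat.lt_two_pow_self
      have h2 : ((2 * q : ℕ) : ℝ) ≤ ((2 * k : ℕ) : ℝ) := by push_cast; linarith [hk.1]
      have h3 : 2 * q ≤ 2 * k := by exact_mod_cast h2
      omega
    · have : ((2 * 2 ^ (2 * k + 1) : ℕ) : ℝ) ≤ n := by
        rw [← hnx]
        calc ((2 * 2 ^ (2 * k + 1) : ℕ) : ℝ) = (2 : ℝ) ^ ((2 * k + 2 : ℕ) : ℝ) := by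
              rw [Real.rpow_natCast]; push_cast; ring
          _ ≤ 2 ^ x := by
              apply Real.rpow_le_rpow_of_exponent_le (by norm_num)
              push_cast; linarith [hk.2]
      exact_mod_cast this
  · have h1 := Nat.ceil_lt_add_one (by linarith : 0 ≤ x / 8)
    have h2 := Nat.lt_floor_add_one (3 * x / 8)
    rw [Nat.card_Icc]
    have h3 : (⌊3 * x / 8⌋₊ : ℝ) + 1 - ⌈x / 8⌉₊ ≤ ((⌊3 * x / 8⌋₊ + 1 - ⌈x / 8⌉₊ : ℕ) : ℝ) := by
      rw [sub_le_iff_le_add]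
      exact_mod_cast le_tsub_add
    have h4 : (4 : ℝ) ^ q ≤ 8 * ((⌊3 * x / 8⌋₊ + 1 - ⌈x / 8⌉₊ : ℕ) : ℝ) := by linarith
    exact_mod_cast h4

/-- Few conditional samples do not distinguish the even from the odd uniblock distribution. -/
lemma uniblock_indistinguishable {η : ℝ} (hη : 0 < η) :
    ∃ N : ℕ, ∀ n : ℕ, N ≤ n → (blockExponents n).Nonempty ∧
      (∀ k ∈ blockExponents n, 2 * 2 ^ (2 * k + 1) ≤ n) ∧
      ∀ t : ℕ, (t : ℝ) ≤ Real.sqrt (Real.logb 2 (Real.logb 2 n) / 32) →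
        ∀ T : AdaptiveAlgorithm n,
          |uniblockExpect 0 n (fun p => T.outputProb t p true) -
            uniblockExpect 1 n (fun p => T.outputProb t p true)| ≤ η := by
  obtain ⟨N, hN⟩ := eventually_exists_depth hη
  refine ⟨N, fun n hn => ?_⟩
  obtain ⟨q, hq, htq, hK, hcard, hbound⟩ := hN n hn
  have hB : (blockExponents n).Nonempty := by
    rw [← Finset.card_pos]
    have : 0 < 4 ^ q := by positivity
    omega
  refine ⟨hB, fun k hk => (hK k hk).2, fun t ht T => ?_⟩
  refine (abs_uniblockExpect_outputProb_sub_le T true hq (htq t ht) hB hK).trans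
    (le_trans ?_ hbound)
  have hB0 : (0 : ℝ) < (blockExponents n).card := by exact_mod_cast hB.card_pos
  have htq' : (t : ℝ) ≤ q := by exact_mod_cast htq t ht
  have h2q : (0 : ℝ) < 2 ^ q := by positivity
  have hcard' : (2 ^ q : ℝ) * 2 ^ q ≤ 8 * (blockExponents n).card := by
    rw [← mul_pow]; norm_num; exact_mod_cast hcard
  have h1 : (2 ^ t - 1 : ℝ) * (2 * q + 1) / (blockExponents n).card ≤
      8 * (2 * q + 1) / 2 ^ q := by
    rw [div_le_div_iff₀ hB0 h2q]
    have h3 : (2 ^ t - 1 : ℝ) ≤ 2 ^ q := by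
      have : (2 : ℝ) ^ t ≤ 2 ^ q := pow_le_pow_right₀ (by norm_num) (htq t ht)
      linarith
    calc (2 ^ t - 1 : ℝ) * (2 * q + 1) * 2 ^ q ≤ 2 ^ q * (2 * q + 1) * 2 ^ q := by gcongr
      _ = (2 * q + 1) * (2 ^ q * 2 ^ q) := by ring
      _ ≤ (2 * q + 1) * (8 * (blockExponents n).card) := by gcongr
      _ = _ := by ring
  have h2 : (t : ℝ) * (8 / 2 ^ q) ≤ 8 * q / 2 ^ q := by
    rw [mul_div_assoc', mul_comm]; gcongr
  calc _ ≤ 8 * (2 * q + 1) / 2 ^ q + 8 * q / (2 : ℝ) ^ q := add_le_add h1 h2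
    _ = _ := by ring

end Asymptotics

/-! ### Label invariance, distance, and the lower bound for testers -/

section Property

lemma uDist_mem_stdSimplex {n : ℕ} {U : Finset (Fin n)} (hU : U.Nonempty) :
    uDist U ∈ stdSimplex ℝ (Fin n) := by
  refine ⟨uDist_nonneg U, ?_⟩
  have : (U.card : ℝ) ≠ 0 := by exact_mod_cast hU.card_pos.ne'
  rw [sum_uDist_eq_card_inter, Finset.univ_inter, div_self this]

lemma labelInvariant_uniblock (s : ℕ) : LabelInvariant (uniblock s) := by
  rintro n σ μ ν hν ⟨k, hk, U, hU, hμ⟩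
  refine ⟨k, hk, U.map σ.symm.toEmbedding, by rw [Finset.card_map, hU], ?_⟩
  funext i
  rw [hν i, hμ]
  simp [uDist]

lemma variationDist_comm {n : ℕ} (p p' : Fin n → ℝ) :
    variationDist p p' = variationDist p' p := by
  simp [variationDist, abs_sub_comm]

/-- The set `V` carries all the mass of its own distribution but at most half the mass of the other.
-/
lemma half_le_variationDist_uDist {n : ℕ} {U V : Finset (Fin n)} (hV : V.Nonempty)
    (hVU : 2 * V.card ≤ U.card) : 1 / 2 ≤ variationDist (uDist U) (uDist V) := by
  have hv : (0 : ℝ) < V.card := by exact_mod_cast hV.card_pos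
  have hU : U.Nonempty := by
    rw [← Finset.card_pos]; have := hV.card_pos; omega
  have hu : (0 : ℝ) < U.card := by exact_mod_cast hU.card_pos
  have hle : ∑ i ∈ V, uDist U i ≤ 1 / 2 := by
    rw [sum_uDist_eq_card_inter, div_le_div_iff₀ hu (by norm_num)]
    have : (V ∩ U).card ≤ V.card := Finset.card_le_card Finset.inter_subset_left
    exact_mod_cast (by omega : (V ∩ U).card * 2 ≤ 1 * U.card)
  have hVV : ∑ i ∈ V, uDist V i = 1 := by
    rw [sum_uDist_eq_card_inter, Finset.inter_self, div_self hv.ne']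
  have h1 : ∑ i ∈ V, (uDist V i - uDist U i) ≤ ∑ i ∈ V, |uDist U i - uDist V i| :=
    Finset.sum_le_sum fun i _ => by rw [abs_sub_comm]; exact le_abs_self _
  have h2 : ∑ i ∈ Vᶜ, (uDist U i - uDist V i) ≤ ∑ i ∈ Vᶜ, |uDist U i - uDist V i| :=
    Finset.sum_le_sum fun i _ => le_abs_self _
  have h3 := (uDist_mem_stdSimplex hU).2
  have h4 := (uDist_mem_stdSimplex hV).2
  rw [← Finset.sum_add_sum_compl V] at h3 h4
  rw [Finset.sum_sub_distrib] at h1 h2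
  unfold variationDist
  rw [← Finset.sum_add_sum_compl V]
  linarith

lemma isFar_uniblock_one {n : ℕ} {μ : Dist n} (hμ : μ ∈ uniblock 1 n) :
    IsFar (1 / 2) μ (uniblock 0 n) := by
  obtain ⟨k, -, U, hU, hμ⟩ := hμ
  rintro ν ⟨l, -, V, hV, hν⟩
  have hpU : 0 < U.card := hU ▸ by positivity
  have hpV : 0 < V.card := hV ▸ by positivity
  rw [hμ, hν]
  -- The exponents `2k + 1` and `2l` have different parity, so one exceeds the other by at least 1
  -- and the larger set is at least twice the smaller.
  rcases Nat.lt_or_ge k l with h | h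
  · rw [variationDist_comm]
    refine half_le_variationDist_uDist (Finset.card_pos.1 hpU) ?_
    rw [hU, hV, ← pow_succ']
    exact Nat.pow_le_pow_right (by norm_num) (by omega)
  · refine half_le_variationDist_uDist (Finset.card_pos.1 hpV) ?_
    rw [hU, hV, ← pow_succ']
    exact Nat.pow_le_pow_right (by norm_num) (by omega)

lemma uniblock_tester_lower_bound {δ : ℝ} (hδ : δ < 1 / 2) :
    ∃ N : ℕ, ∀ n : ℕ, N ≤ n → ∀ ε : ℝ, ε ≤ 1 / 2 → ∀ (t : ℕ) (T : AdaptiveAlgorithm n),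
      IsAdaptiveTester (uniblock 0) ε δ n t T →
        Real.sqrt (Real.logb 2 (Real.logb 2 n) / 32) < t := by
  -- A tester separates the acceptance probabilities by at least `1 - 2δ`; half of that gap is a
  -- positive tolerance that leads to a contradiction.
  obtain ⟨N, hN⟩ := uniblock_indistinguishable (η := (1 - 2 * δ) / 2) (by linarith)
  refine ⟨N, fun n hn ε hε t T hT => ?_⟩
  obtain ⟨hB, hK, hind⟩ := hN n hn
  by_contra! ht
  have h := hind t ht T
  have hne : ∀ {k s : ℕ} {U : Finset (Fin n)}, U.card = 2 ^ (2 * k + s) → U.Nonempty :=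
    fun hU => Finset.card_pos.1 (hU ▸ by positivity)
  have heven : 1 - δ ≤ uniblockExpect 0 n (fun p => T.outputProb t p true) := by
    rw [← uniblockExpect_const (s := 0) hB _ (1 - δ)]
    · exact uniblockExpect_mono fun k hk U hU =>
        hT.1 ⟨uDist U, uDist_mem_stdSimplex (hne hU)⟩ ⟨k, hk, U, hU, rfl⟩
    · intro k hk
      have := hK k hk
      have : 2 ^ (2 * k + 0) ≤ 2 ^ (2 * k + 1) := Nat.pow_le_pow_right (by norm_num) (by omega)
      omega
  have hodd : uniblockExpect 1 n (fun p => T.outputProb t p true) ≤ δ := by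
    rw [← uniblockExpect_const (s := 1) hB _ δ]
    · refine uniblockExpect_mono fun k hk U hU => ?_
      have h1 := hT.2 ⟨uDist U, uDist_mem_stdSimplex (hne hU)⟩
        fun ν hν => hε.trans (isFar_uniblock_one ⟨k, hk, U, hU, rfl⟩ ν hν)
      have h2 := T.outputProb_true_add_false t (uDist_nonneg U)
      simp only at h1
      linarith
    · intro k hk
      have := hK k hk
      omega
  have := (le_abs_self _).trans h
  linarith

end Property

end CondTest

end

/-- With `uniblock 0` the property of being uniform over a set of size `2 ^ (2 * k)` for some
integer `k` between `(log n) / 8` and `3 (log n) / 8`. -/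
theorem mainTheorem11 :
    -- the property is label-invariant
    CondTest.LabelInvariant (CondTest.uniblock 0) ∧
    -- testing it takes more than `√(log log n / 32)` conditional samples for all large `n`
    (∀ δ : ℝ, 0 < δ → δ < 1 / 2 → ∃ N : ℕ, ∀ n : ℕ, N ≤ n → ∀ ε : ℝ, 0 < ε → ε ≤ 1 / 2 →
      ∀ (t : ℕ) (T : CondTest.AdaptiveAlgorithm n),
        CondTest.IsAdaptiveTester (CondTest.uniblock 0) ε δ n t T →
          Real.sqrt (Real.logb 2 (Real.logb 2 n) / 32) < t) ∧
    -- odd outcomes are `1/2`-far from all even ones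
    (∀ (n : ℕ) (μ : CondTest.Dist n), μ ∈ CondTest.uniblock 1 n →
      CondTest.IsFar (1 / 2) μ (CondTest.uniblock 0 n)) ∧
    -- no adaptive algorithm with few samples distinguishes the even and the odd distribution
    (∀ η : ℝ, 0 < η → ∃ N : ℕ, ∀ n : ℕ, N ≤ n → ∀ t : ℕ,
      (t : ℝ) ≤ Real.sqrt (Real.logb 2 (Real.logb 2 n) / 32) →
        ∀ T : CondTest.AdaptiveAlgorithm n,
          |CondTest.uniblockExpect 0 n (fun p => T.outputProb t p true) -
            CondTest.uniblockExpect 1 n (fun p => T.outputProb t p true)| ≤ η) := by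
  refine ⟨CondTest.labelInvariant_uniblock 0, fun δ _ hδ => ?_,
    fun n μ hμ => CondTest.isFar_uniblock_one hμ, fun η hη => ?_⟩
  · obtain ⟨N, hN⟩ := CondTest.uniblock_tester_lower_bound hδ
    exact ⟨N, fun n hn ε _ hε => hN n hn ε hε⟩
  · obtain ⟨N, hN⟩ := CondTest.uniblock_indistinguishable hη
    exact ⟨N, fun n hn => (hN n hn).2.2⟩
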